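/- Let $A\ge 2$ be an integer and let $T=(V,E)$ be the infinite rooted tree in which each node has exactly $A$ children: $V=\{(j,k): j\in\mathbb N,\ 1\le k\le A^j\}$, and the children of $(j,k)$ are $(j+1,A(k-1)+1),\dots,(j+1,Ak)$. Let $d_T$ be the graph distance, with $d_T(I,J)=\inf_{v\in I,w\in J}d_T(v,w)$ for $I,J\subseteq V$, and let $V_L=\{(j,k)\in V: 0\le j\le L-1\}$ be the set of nodes of the first $L$ generations. Let $Z=\{Z_v:v\in V\}$ be real random variables on a probability space $(\Omega,\mathcal A,\mathbb P)$ with $\mathbb E[Z_v]=0$, $\|Z_v\|_\infty\le C$ and $\mathrm{Var}(Z_v)\le\sigma^2$ for all $v\in V$, where $0<C,\sigma<\infty$. For $n\in\mathbb N$ let $$\alpha_T(n)=\sup_{I,J\subseteq V,\ d_T(I,J)\ge n}\ \ \sup_{F\in\sigma(Z_v:v\in I),\ G\in\sigma(Z_v:v\in J)}|\mathbb P(F\cap G)-\mathbb P(F)\mathbb P(G)|$$ and assume that $\alpha_T(n)\to0$ as $n\to\infty$. For $P,k\ge1$ let $N(P,k)$ be the number of ordered pairs $(v,w)\in V_P\times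 V_P$ with $d_T(v,w)=k$ (so that $N(P,k)=0$ for $k>2(P-1)$), and consider the condition $$\sum_{k\ge1}\alpha_T(k)\,N(P,k)=O(P A^P)\quad\text{as } P\to\infty.\tag{$*$}$$ (i) If the mixing coefficients decay at a super-exponential rate, i.e. if there is a positive increasing function $g$ with $g(n)\to\infty$ and $\alpha_T(n)\le\exp(-n\,g(n))$ for all $n\in\mathbb N$, then $(*)$ holds. (ii) If $(*)$ holds, then there are constants $c_1,c_2>0$ such that for all integers $L\ge2$ and all $\varepsilon>0$ $$\mathbb P\left(\frac1{|V_L|}\left|\sum_{v\in V_L}Z_v\right|>\varepsilon\right)\le c_1\exp\left(-c_2\,\varepsilon\,\frac{L}{\log L}\right).$$ -/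

import Mathlib

open MeasureTheory ProbabilityTheory Filter Asymptotics

namespace ExpTree

/-- The `σ`-algebra `F(I)` generated by the variables `Z v`, `v ∈ I`. -/
abbrev sigmaOn {V Ω : Type*} (Z : V → Ω → ℝ) (I : Set V) : MeasurableSpace Ω :=
  ⨆ v ∈ I, MeasurableSpace.comap (Z v) (borel ℝ)

/-- The `α`-mixing coefficient of the random field `Z` on the graph `G`: the supremum of
`|P(A ∩ B) - P(A) P(B)|` over all sets `I`, `J` of nodes with `d_G(I, J) ≥ n` and all events
`A ∈ F(I)`, `B ∈ F(J)`. All these numbers lie in `[0, 1]`, and `0` is one of them. -/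
noncomputable def alphaMixing {V Ω : Type*} [MeasurableSpace Ω] (G : SimpleGraph V)
    (μ : Measure Ω) (Z : V → Ω → ℝ) (n : ℕ) : ℝ :=
  sSup {x : ℝ | ∃ I J : Set V, (∀ v ∈ I, ∀ w ∈ J, (n : ℕ∞) ≤ G.edist v w) ∧
    ∃ A B : Set Ω, MeasurableSet[sigmaOn Z I] A ∧ MeasurableSet[sigmaOn Z J] B ∧
      x = |μ.real (A ∩ B) - μ.real A * μ.real B|}

/-- The random field `Z` is strong mixing with respect to the graph `G`. -/
def StrongMixing {V Ω : Type*} [MeasurableSpace Ω] (G : SimpleGraph V)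
    (μ : Measure Ω) (Z : V → Ω → ℝ) : Prop :=
  Tendsto (alphaMixing G μ Z) atTop (nhds 0)

/-- The nodes of the infinite rooted `A`-ary tree: `⟨j, k⟩` is the node number `k` of generation
`j`, where `k` runs through `0, …, A ^ j - 1`. -/
abbrev Node (A : ℕ) : Type := Σ j : ℕ, Fin (A ^ j)

/-- The node `w` is a child of `v`: it lies in the next generation, and its number is one of
`A * k, …, A * k + A - 1`, where `k` is the number of `v`. -/
def IsChild (A : ℕ) (v w : Node A) : Prop :=
  w.1 = v.1 + 1 ∧ A * (v.2 : ℕ) ≤ (w.2 : ℕ) ∧ (w.2 : ℕ) < A * ((v.2 : ℕ) + 1)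

/-- The infinite rooted `A`-ary tree, the tree growing at the exponential rate `A`. -/
def tree (A : ℕ) : SimpleGraph (Node A) := SimpleGraph.fromRel (IsChild A)

/-- The nodes of the first `L` generations `0, …, L - 1`. -/
def generations (A L : ℕ) : Finset (Node A) :=
  (Finset.range L).sigma fun _ => Finset.univ

open scoped Classical in
/-- `N(P, k)`: the number of (ordered) pairs of nodes among `P` consecutive generations of a
subtree, here the one rooted at the root, that are separated by exactly `k` edges. -/
noncomputable def numPairs (A P k : ℕ) : ℕ :=
  ((generations A P ×ˢ generations A P).filter
    fun p => (tree A).edist p.1 p.2 = (k : ℕ∞)).card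

/-- The mixing condition `∑ₖ α(k) N(P, k) ∈ O(P A ^ P)` as `P → ∞`; distances between different
nodes among `P` generations are between `1` and `2 (P - 1)`. -/
def SummableMixing (A : ℕ) (α : ℕ → ℝ) : Prop :=
  (fun P : ℕ => ∑ k ∈ Finset.Icc 1 (2 * (P - 1)), α k * (numPairs A P k : ℝ))
    =O[atTop] fun P : ℕ => (P : ℝ) * (A : ℝ) ^ P

/-- Decay at a super-exponential rate: `α(n) ≤ exp (- n g(n))` for some positive increasing `g`
with `g(n) → ∞`. -/
def SuperExponentialDecay (α : ℕ → ℝ) : Prop :=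
  ∃ g : ℕ → ℝ, (∀ n, 0 < g n) ∧ Monotone g ∧ Tendsto g atTop atTop ∧
    ∀ n : ℕ, α n ≤ Real.exp (-((n : ℝ) * g n))

end ExpTree

/-! Chebyshev's inequality suffices, because `V_L` has exponentially many nodes. Off the diagonal,
the covariance inequality `|cov| ≤ 4 C² α(d)` and grouping by distance turn the variance of the sum
into the sum in `(*)`, so it is `O(L A^L)`. As `|V_L| ≥ A^(L-1)`, the deviation probability is `O(L
/ (2^L ε²))`. It vanishes for `ε ≥ C`. For `ε ≤ C` the target exponent is at most linear in `L`, and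
either the target bound is trivial or `1/ε²` costs only a factor `L²`, which half of the exponential
decay absorbs.

For (i), `N(P, k) ≤ A^P (A+1)^k`, and super-exponential decay makes `∑ α(k) (A+1)^k` converge. -/

namespace ExpTree

/-! ### Covariance inequality for bounded variables -/

section Covariance

variable {Ω : Type*} {m m' : MeasurableSpace Ω} [mΩ : MeasurableSpace Ω] {μ : Measure Ω}
  [IsProbabilityMeasure μ]

/-- If the set integrals of `Y` over the events of `m` are almost those of the constant `𝔼[Y]`,
then `Y` is almost uncorrelated with the bounded `m`-measurable variables. -/
lemma abs_integral_mul_sub_le_of_setIntegral (hm : m ≤ mΩ)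
    {X Y : Ω → ℝ} {C D : ℝ} (hC : 0 ≤ C) (hX : StronglyMeasurable[m] X)
    (hXC : ∀ᵐ ω ∂μ, ‖X ω‖ ≤ C) (hY : Integrable Y μ)
    (hD : ∀ B, MeasurableSet[m] B → |∫ ω in B, Y ω ∂μ - μ.real B * ∫ ω, Y ω ∂μ| ≤ D) :
    |∫ ω, X ω * Y ω ∂μ - (∫ ω, X ω ∂μ) * ∫ ω, Y ω ∂μ| ≤ C * (2 * D) := by
  set e := ∫ ω, Y ω ∂μ with he
  set W : Ω → ℝ := fun ω => (μ[Y | m]) ω - e with hW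
  have hXm : AEStronglyMeasurable X μ := (hX.mono hm).aestronglyMeasurable
  have hXint : Integrable X μ := Integrable.of_bound hXm C hXC
  have hWint : Integrable W μ := integrable_condExp.sub (integrable_const e)
  have hWm : StronglyMeasurable[m] W := stronglyMeasurable_condExp.sub stronglyMeasurable_const
  have hset : ∀ B, MeasurableSet[m] B →
      ∫ ω in B, W ω ∂μ = ∫ ω in B, Y ω ∂μ - μ.real B * e := by
    intro B hB
    rw [hW, integral_sub integrable_condExp.integrableOn (integrable_const e).integrableOn,
      setIntegral_condExp hm hY hB, setIntegral_const, smul_eq_mul]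
  have hXW : ∫ ω, X ω * W ω ∂μ = ∫ ω, X ω * Y ω ∂μ - (∫ ω, X ω ∂μ) * e := by
    have h1 : ∫ ω, X ω * (μ[Y | m]) ω ∂μ = ∫ ω, X ω * Y ω ∂μ :=
      calc ∫ ω, X ω * (μ[Y | m]) ω ∂μ = ∫ ω, (μ[X * Y | m]) ω ∂μ :=
            integral_congr_ae (condExp_stronglyMeasurable_mul_of_bound hm hX hY C hXC).symm
        _ = ∫ ω, X ω * Y ω ∂μ := integral_condExp hm
    rw [← h1, ← integral_mul_const, ← integral_sub]
    · simp only [hW, mul_sub]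
    · exact integrable_condExp.bdd_mul hXm hXC
    · exact hXint.mul_const e
  -- The `L¹` norm of `W` is tested on the set where `W ≥ 0` and on its complement; each contributes
  -- at most `D`.
  have hB : MeasurableSet[m] {ω | 0 ≤ W ω} := measurableSet_le measurable_const hWm.measurable
  have habs : ∫ ω, |W ω| ∂μ ≤ 2 * D := by
    rw [← integral_add_compl (hm _ hB) hWint.abs]
    have h1 : ∫ ω in {ω | 0 ≤ W ω}, |W ω| ∂μ = ∫ ω in {ω | 0 ≤ W ω}, W ω ∂μ :=
      setIntegral_congr_fun (hm _ hB) fun ω hω => abs_of_nonneg hω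
    have h2 : ∫ ω in {ω | 0 ≤ W ω}ᶜ, |W ω| ∂μ = -∫ ω in {ω | 0 ≤ W ω}ᶜ, W ω ∂μ := by
      rw [← integral_neg]
      exact setIntegral_congr_fun (hm _ hB.compl) fun ω hω => abs_of_neg (not_le.1 hω)
    have h3 := hD _ hB
    have h4 := hD _ hB.compl
    rw [← hset _ hB] at h3
    rw [← hset _ hB.compl] at h4
    rw [h1, h2]
    linarith [le_abs_self (∫ ω in {ω | 0 ≤ W ω}, W ω ∂μ),
      neg_le_abs (∫ ω in {ω | 0 ≤ W ω}ᶜ, W ω ∂μ)]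
  rw [← hXW]
  calc |∫ ω, X ω * W ω ∂μ| ≤ ∫ ω, |X ω * W ω| ∂μ := abs_integral_le_integral_abs
    _ ≤ ∫ ω, C * |W ω| ∂μ := by
        refine integral_mono_ae (hWint.bdd_mul hXm hXC).abs (hWint.abs.const_mul C) ?_
        filter_upwards [hXC] with ω hω
        simpa only [abs_mul, Real.norm_eq_abs] using mul_le_mul_of_nonneg_right hω (abs_nonneg (W ω))
    _ = C * ∫ ω, |W ω| ∂μ := integral_const_mul _ _
    _ ≤ C * (2 * D) := mul_le_mul_of_nonneg_left habs hC

/-- The covariance inequality for bounded variables under `α`-mixing. -/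
lemma abs_integral_mul_sub_le_of_mixing (hm : m ≤ mΩ) (hm' : m' ≤ mΩ)
    {X Y : Ω → ℝ} {C a : ℝ} (hC : 0 ≤ C)
    (hX : StronglyMeasurable[m] X) (hXC : ∀ᵐ ω ∂μ, ‖X ω‖ ≤ C)
    (hY : StronglyMeasurable[m'] Y) (hYC : ∀ᵐ ω ∂μ, ‖Y ω‖ ≤ C)
    (ha : ∀ B B', MeasurableSet[m] B → MeasurableSet[m'] B' →
      |μ.real (B ∩ B') - μ.real B * μ.real B'| ≤ a) :
    |∫ ω, X ω * Y ω ∂μ - (∫ ω, X ω ∂μ) * ∫ ω, Y ω ∂μ| ≤ 4 * C ^ 2 * a := by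
  have hYint : Integrable Y μ := Integrable.of_bound (hY.mono hm').aestronglyMeasurable C hYC
  -- The previous lemma is used twice: here for `X` against `Y`, and below for `Y` against an
  -- indicator, which supplies this `D`. Each use costs a factor `2 C`.
  have key := abs_integral_mul_sub_le_of_setIntegral (D := C * (2 * a)) hm hC hX hXC hYint ?_
  · linarith
  intro B hB
  have hone : ∫ ω, B.indicator (fun _ => (1 : ℝ)) ω ∂μ = μ.real B := by
    rw [integral_indicator (hm _ hB)]; simp
  have h := abs_integral_mul_sub_le_of_setIntegral (μ := μ) (D := a)
    (Y := B.indicator fun _ => (1 : ℝ)) hm' hC hY hYC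
    ((integrable_const (1 : ℝ)).indicator (hm _ hB)) ?_
  · rw [hone, mul_comm (∫ ω, Y ω ∂μ)] at h
    convert h using 3
    rw [← integral_indicator (hm _ hB)]
    congr 1
    ext ω
    by_cases hω : ω ∈ B <;> simp [hω]
  · intro B' hB'
    rw [hone, setIntegral_indicator (hm _ hB)]
    simpa [Set.inter_comm, mul_comm] using ha B B' hB hB'

end Covariance

/-! ### Mixing coefficients bound covariances -/

section AlphaMixing

variable {V Ω : Type*} [MeasurableSpace Ω] (G : SimpleGraph V) (μ : Measure Ω)
  (Z : V → Ω → ℝ)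

lemma alphaMixing_nonneg (n : ℕ) : 0 ≤ alphaMixing G μ Z n := by
  refine Real.sSup_nonneg ?_
  rintro x ⟨I, J, -, A, B, -, -, rfl⟩
  exact abs_nonneg _

variable [IsProbabilityMeasure μ]

lemma alphaMixing_bddAbove (n : ℕ) :
    BddAbove {x : ℝ | ∃ I J : Set V, (∀ v ∈ I, ∀ w ∈ J, (n : ℕ∞) ≤ G.edist v w) ∧
      ∃ A B : Set Ω, MeasurableSet[sigmaOn Z I] A ∧ MeasurableSet[sigmaOn Z J] B ∧
        x = |μ.real (A ∩ B) - μ.real A * μ.real B|} := by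
  refine ⟨1, ?_⟩
  rintro x ⟨I, J, -, A, B, -, -, rfl⟩
  have h1 : μ.real (A ∩ B) ≤ 1 := measureReal_le_one
  have h2 : μ.real A * μ.real B ≤ 1 :=
    mul_le_one₀ measureReal_le_one measureReal_nonneg measureReal_le_one
  have h3 : 0 ≤ μ.real (A ∩ B) := measureReal_nonneg
  have h4 : 0 ≤ μ.real A * μ.real B := mul_nonneg measureReal_nonneg measureReal_nonneg
  exact abs_le.2 ⟨by linarith, by linarith⟩

lemma abs_sub_le_alphaMixing {n : ℕ} {v w : V} (h : (n : ℕ∞) ≤ G.edist v w) {A B : Set Ω}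
    (hA : MeasurableSet[MeasurableSpace.comap (Z v) (borel ℝ)] A)
    (hB : MeasurableSet[MeasurableSpace.comap (Z w) (borel ℝ)] B) :
    |μ.real (A ∩ B) - μ.real A * μ.real B| ≤ alphaMixing G μ Z n := by
  refine le_csSup (alphaMixing_bddAbove G μ Z n) ⟨{v}, {w}, ?_, A, B, ?_, ?_, rfl⟩
  · rintro _ rfl _ rfl
    exact h
  · rwa [show sigmaOn Z {v} = _ from iSup_singleton]
  · rwa [show sigmaOn Z {w} = _ from iSup_singleton]

variable {G μ Z}

/-- The covariance of two variables of a centered bounded field is controlled by the mixing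
coefficient of their distance. -/
lemma abs_covariance_le_alphaMixing (hZ : ∀ v, Measurable (Z v)) {C : ℝ} (hC : 0 ≤ C)
    (hbdd : ∀ v, ∀ᵐ ω ∂μ, |Z v ω| ≤ C) {n : ℕ} {v w : V} (h : (n : ℕ∞) ≤ G.edist v w) :
    |cov[Z v, Z w; μ]| ≤ 4 * C ^ 2 * alphaMixing G μ Z n := by
  have hL : ∀ v, MemLp (Z v) 2 μ := fun v =>
    MemLp.of_bound (hZ v).aestronglyMeasurable C (hbdd v)
  rw [covariance_eq_sub (hL v) (hL w)]
  exact abs_integral_mul_sub_le_of_mixing (hZ v).comap_le (hZ w).comap_le hC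
    (comap_measurable (Z v)).stronglyMeasurable (hbdd v)
    (comap_measurable (Z w)).stronglyMeasurable (hbdd w)
    fun B B' hB hB' => abs_sub_le_alphaMixing G μ Z h hB hB'

end AlphaMixing

/-! ### Counting nodes and pairs in the tree -/

section Tree

variable {A : ℕ}

lemma card_generations (A L : ℕ) : (generations A L).card = ∑ j ∈ Finset.range L, A ^ j := by
  simp [generations, Finset.card_sigma]

lemma card_generations_le (hA : 2 ≤ A) (L : ℕ) : (generations A L).card ≤ A ^ L := by
  rw [card_generations]
  exact (Nat.geomSum_lt hA fun k hk => Finset.mem_range.1 hk).le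

lemma pow_le_mul_card_generations {L : ℕ} (hL : 1 ≤ L) : A ^ L ≤ A * (generations A L).card := by
  obtain ⟨k, rfl⟩ := Nat.exists_eq_add_of_le' hL
  rw [card_generations, Finset.sum_range_succ, pow_succ']
  exact Nat.mul_le_mul_left _ (Nat.le_add_left _ _)

lemma mem_generations {L : ℕ} {v : Node A} : v ∈ generations A L ↔ v.1 < L := by
  simp [generations]

/-- The parent of a node; the root is its own parent. -/
def parent (A : ℕ) : Node A → Node A
  | ⟨0, k⟩ => ⟨0, k⟩
  | ⟨j + 1, k⟩ => ⟨j, (k : ℕ) / A,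
      Nat.div_lt_of_lt_mul (k.2.trans_eq (pow_succ' A j))⟩

/-- The `A` children of a node. -/
def child (v : Node A) (i : Fin A) : Node A :=
  ⟨v.1 + 1, A * v.2 + i, by
    have h1 : A * ((v.2 : ℕ) + 1) ≤ A * A ^ v.1 := Nat.mul_le_mul_left A v.2.2
    have h2 := i.2
    rw [pow_succ']
    lia⟩

lemma isChild_parent (hA : 0 < A) (j : ℕ) (k : Fin (A ^ (j + 1))) :
    IsChild A (parent A ⟨j + 1, k⟩) ⟨j + 1, k⟩ :=
  ⟨rfl, Nat.mul_div_le _ _, Nat.lt_mul_div_succ _ hA⟩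

lemma IsChild.exists_eq_child {v w : Node A} (h : IsChild A v w) : ∃ i, w = child v i := by
  obtain ⟨j, k⟩ := v
  obtain ⟨l, n⟩ := w
  obtain ⟨h1, h2, h3⟩ := h
  dsimp only at h1 h2 h3
  subst h1
  obtain ⟨i, hi⟩ := Nat.exists_eq_add_of_le h2
  rw [mul_add, mul_one, hi] at h3
  refine ⟨⟨i, Nat.lt_of_add_lt_add_left h3⟩, ?_⟩
  simp only [child, Sigma.mk.injEq, heq_eq_eq, true_and]
  exact Fin.ext hi

lemma IsChild.eq_parent {v w : Node A} (h : IsChild A v w) : v = parent A w := by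
  obtain ⟨j, k⟩ := v
  obtain ⟨l, n⟩ := w
  obtain ⟨h1, h2, h3⟩ := h
  dsimp only at h1 h2 h3
  subst h1
  simp only [parent, Sigma.mk.injEq, heq_eq_eq, true_and]
  ext
  simp only
  refine (Nat.div_eq_of_lt_le ?_ ?_).symm
  · rwa [mul_comm]
  · rwa [mul_comm]

open scoped Classical in
/-- The neighbors of a node (and possibly the node itself). -/
noncomputable def neighbors (v : Node A) : Finset (Node A) :=
  insert (parent A v) (Finset.univ.image (child v))

lemma card_neighbors_le (v : Node A) : (neighbors v).card ≤ A + 1 :=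
  (Finset.card_insert_le _ _).trans
    (Nat.add_le_add_right (Finset.card_image_le.trans_eq (by simp)) 1)

lemma mem_neighbors_of_adj {v w : Node A} (h : (tree A).Adj v w) : w ∈ neighbors v := by
  rw [tree, SimpleGraph.fromRel_adj] at h
  simp only [neighbors, Finset.mem_insert, Finset.mem_image, Finset.mem_univ, true_and]
  rcases h.2 with h | h
  · obtain ⟨i, rfl⟩ := h.exists_eq_child
    exact .inr ⟨i, rfl⟩
  · exact .inl h.eq_parent

/-- The nodes that are joined to `v` by a walk of length `k` lie in a set of `(A + 1) ^ k` nodes. -/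
lemma exists_finset_walk_length (v : Node A) (k : ℕ) :
    ∃ s : Finset (Node A), s.card ≤ (A + 1) ^ k ∧
      ∀ w, ∀ p : (tree A).Walk w v, p.length = k → w ∈ s := by
  classical
  induction k with
  | zero =>
    refine ⟨{v}, by simp, fun w p hp => ?_⟩
    simpa using SimpleGraph.Walk.eq_of_length_eq_zero hp
  | succ k ih =>
    obtain ⟨s, hs, hmem⟩ := ih
    refine ⟨s.biUnion neighbors, ?_, fun w p hp => ?_⟩
    · rw [pow_succ]
      exact (Finset.card_biUnion_le_card_mul _ _ _ fun u _ => card_neighbors_le u).trans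
        (Nat.mul_le_mul_right _ hs)
    · cases p with
      | nil => simp at hp
      | cons hadj q =>
        rw [Finset.mem_biUnion]
        exact ⟨_, hmem _ q (by simpa using hp), mem_neighbors_of_adj hadj.symm⟩

/-- Crude: shortest paths are counted as walks, with at most `A + 1` choices per step.
Super-exponential decay beats any base. -/
lemma numPairs_le (hA : 2 ≤ A) (P k : ℕ) : numPairs A P k ≤ A ^ P * (A + 1) ^ k := by
  classical
  choose s hs hmem using fun v : Node A => exists_finset_walk_length v k
  have hsub : ((generations A P ×ˢ generations A P).filter
      fun p => (tree A).edist p.1 p.2 = (k : ℕ∞)) ⊆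
      (generations A P).biUnion fun v => (s v).image fun w => (v, w) := by
    rintro ⟨v, w⟩ h
    rw [Finset.mem_filter, Finset.mem_product] at h
    rw [Finset.mem_biUnion]
    obtain ⟨p, hp⟩ := SimpleGraph.exists_walk_of_edist_eq_coe h.2
    exact ⟨v, h.1.1, Finset.mem_image_of_mem _ (hmem v w p.reverse (by simpa using hp))⟩
  calc numPairs A P k ≤ _ := (Finset.card_le_card hsub)
    _ ≤ (generations A P).card * (A + 1) ^ k :=
        Finset.card_biUnion_le_card_mul _ _ _ fun v _ => Finset.card_image_le.trans (hs v)
    _ ≤ A ^ P * (A + 1) ^ k := Nat.mul_le_mul_right _ (card_generations_le hA P)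

lemma edist_root_le (hA : 0 < A) (j : ℕ) (k : Fin (A ^ j)) :
    (tree A).edist ⟨j, k⟩ ⟨0, 0, by simp⟩ ≤ j := by
  induction j with
  | zero =>
    have : k = ⟨0, by simp⟩ := Fin.ext (by have := k.2; simp only [pow_zero] at this; lia)
    rw [this]
    simp
  | succ j ih =>
    have hadj : (tree A).Adj ⟨j + 1, k⟩ (parent A ⟨j + 1, k⟩) := by
      rw [tree, SimpleGraph.fromRel_adj]
      refine ⟨fun h => ?_, .inr (isChild_parent hA j k)⟩
      have := congrArg Sigma.fst h
      simp [parent] at this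
    refine SimpleGraph.edist_triangle.trans
      ((add_le_add (SimpleGraph.edist_eq_one_iff_adj.2 hadj).le (ih _)).trans_eq ?_)
    push_cast
    exact add_comm _ _

/-- The detour through the root bounds the distance, so no pair escapes the range of `k` in `(*)`.
-/
lemma exists_edist_eq (hA : 0 < A) {P : ℕ} {v w : Node A} (hv : v ∈ generations A P)
    (hw : w ∈ generations A P) (hne : v ≠ w) :
    ∃ k ∈ Finset.Icc 1 (2 * (P - 1)), (tree A).edist v w = (k : ℕ∞) := by
  have hle : (tree A).edist v w ≤ ((v.1 + w.1 : ℕ) : ℕ∞) := by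
    push_cast
    refine SimpleGraph.edist_triangle.trans (add_le_add (edist_root_le hA v.1 v.2) ?_)
    rw [SimpleGraph.edist_comm]
    exact edist_root_le hA w.1 w.2
  obtain ⟨k, hk⟩ := ENat.ne_top_iff_exists.1 (ne_top_of_le_ne_top (ENat.natCast_ne_top _) hle)
  rw [mem_generations] at hv hw
  rw [← hk, Nat.cast_le] at hle
  have hpos := SimpleGraph.edist_pos_of_ne (G := tree A) hne
  rw [← hk, Nat.cast_pos] at hpos
  exact ⟨k, Finset.mem_Icc.2 ⟨hpos, by lia⟩, hk.symm⟩

/-- Super-exponential decay of the mixing coefficients implies their summability condition. -/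
lemma SuperExponentialDecay.summableMixing (hA : 2 ≤ A) {α : ℕ → ℝ} (hα : ∀ n, 0 ≤ α n)
    (h : SuperExponentialDecay α) : SummableMixing A α := by
  obtain ⟨g, -, -, hg, hle⟩ := h
  have hA1 : (0 : ℝ) < A + 1 := by positivity
  have hsum : Summable fun k : ℕ => α k * ((A : ℝ) + 1) ^ k := by
    refine Summable.of_norm_bounded_eventually_nat (g := fun k : ℕ => Real.exp (-1) ^ k)
      (summable_geometric_of_lt_one (Real.exp_pos _).le (by simp)) ?_
    -- Beyond this threshold `exp (-k g(k))` cancels `(A+1)^k` and leaves `e^(-k)`.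
    filter_upwards [hg.eventually_ge_atTop (1 + Real.log (A + 1))] with k hk
    rw [Real.norm_of_nonneg (mul_nonneg (hα k) (by positivity))]
    calc α k * ((A : ℝ) + 1) ^ k
        ≤ Real.exp (-((k : ℝ) * g k)) * Real.exp (k * Real.log (A + 1)) := by
          rw [Real.exp_nat_mul, Real.exp_log hA1]
          exact mul_le_mul_of_nonneg_right (hle k) (by positivity)
      _ ≤ Real.exp (-1) ^ k := by
          rw [← Real.exp_add, ← Real.exp_nat_mul, Real.exp_le_exp]
          nlinarith [mul_le_mul_of_nonneg_left hk (Nat.cast_nonneg (α := ℝ) k)]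
  refine IsBigO.of_bound (∑' k : ℕ, α k * ((A : ℝ) + 1) ^ k) ?_
  filter_upwards [eventually_ge_atTop 1] with P hP
  have hP' : (1 : ℝ) ≤ P := by exact_mod_cast hP
  rw [Real.norm_of_nonneg (Finset.sum_nonneg fun k _ => mul_nonneg (hα k) (Nat.cast_nonneg _)),
    Real.norm_of_nonneg (by positivity)]
  calc ∑ k ∈ Finset.Icc 1 (2 * (P - 1)), α k * (numPairs A P k : ℝ)
      ≤ ∑ k ∈ Finset.Icc 1 (2 * (P - 1)), α k * ((A : ℝ) + 1) ^ k * (A : ℝ) ^ P := by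
        refine Finset.sum_le_sum fun k _ => ?_
        have := numPairs_le hA P k
        rw [mul_assoc]
        refine mul_le_mul_of_nonneg_left ?_ (hα k)
        rw [mul_comm]
        exact_mod_cast this
    _ = (∑ k ∈ Finset.Icc 1 (2 * (P - 1)), α k * ((A : ℝ) + 1) ^ k) * (A : ℝ) ^ P :=
        (Finset.sum_mul ..).symm
    _ ≤ (∑' k : ℕ, α k * ((A : ℝ) + 1) ^ k) * (P * (A : ℝ) ^ P) := by
        refine mul_le_mul (hsum.sum_le_tsum _ fun k _ => mul_nonneg (hα k) (by positivity))
          (le_mul_of_one_le_left (by positivity) hP') (by positivity)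
          (tsum_nonneg fun k => mul_nonneg (hα k) (by positivity))

end Tree

/-! ### Variance and deviation bounds -/

section Deviation

variable {Ω : Type*} [MeasurableSpace Ω] {μ : Measure Ω} [IsProbabilityMeasure μ]
  {A : ℕ} {Z : Node A → Ω → ℝ}

lemma variance_sum_generations_le (hA : 0 < A) (hZ : ∀ v, Measurable (Z v)) {C σ : ℝ}
    (hC : 0 ≤ C) (hbdd : ∀ v, ∀ᵐ ω ∂μ, |Z v ω| ≤ C) (hvar : ∀ v, variance (Z v) μ ≤ σ ^ 2)
    (L : ℕ) :
    Var[fun ω => ∑ v ∈ generations A L, Z v ω; μ] ≤ (generations A L).card * σ ^ 2 +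
      4 * C ^ 2 * ∑ k ∈ Finset.Icc 1 (2 * (L - 1)),
        alphaMixing (tree A) μ Z k * (numPairs A L k : ℝ) := by
  classical
  set α := alphaMixing (tree A) μ Z with hα
  have hα0 : ∀ n, 0 ≤ α n := alphaMixing_nonneg (tree A) μ Z
  have hL : ∀ v, MemLp (Z v) 2 μ := fun v =>
    MemLp.of_bound (hZ v).aestronglyMeasurable C (hbdd v)
  -- Written as a sum of indicators over `k`, so that exchanging the sums produces `numPairs`.
  have hterm : ∀ v ∈ generations A L, ∀ w ∈ generations A L,
      cov[Z v, Z w; μ] ≤ (if v = w then σ ^ 2 else 0) +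
        ∑ k ∈ Finset.Icc 1 (2 * (L - 1)),
          if (tree A).edist v w = (k : ℕ∞) then 4 * C ^ 2 * α k else 0 := by
    intro v hv w hw
    have hnonneg : ∀ k ∈ Finset.Icc 1 (2 * (L - 1)),
        0 ≤ if (tree A).edist v w = (k : ℕ∞) then 4 * C ^ 2 * α k else 0 := by
      intro k _
      split_ifs
      · exact mul_nonneg (by positivity) (hα0 k)
      · exact le_rfl
    by_cases hvw : v = w
    · subst hvw
      rw [covariance_self (hZ v).aemeasurable, if_pos rfl]
      exact (hvar v).trans (le_add_of_nonneg_right (Finset.sum_nonneg hnonneg))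
    · obtain ⟨k, hk, hdist⟩ := exists_edist_eq hA hv hw hvw
      rw [if_neg hvw, zero_add]
      have h1 := Finset.single_le_sum hnonneg hk
      rw [if_pos hdist] at h1
      exact (le_abs_self _).trans
        ((abs_covariance_le_alphaMixing hZ hC hbdd hdist.ge).trans h1)
  rw [variance_fun_sum' fun v _ => hL v]
  refine (Finset.sum_le_sum fun v hv => Finset.sum_le_sum fun w hw => hterm v hv w hw).trans_eq ?_
  simp_rw [Finset.sum_add_distrib]
  congr 1
  · simp
  · rw [← Finset.sum_product', Finset.sum_comm, Finset.mul_sum]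
    refine Finset.sum_congr rfl fun k _ => ?_
    rw [← Finset.sum_filter, Finset.sum_const, nsmul_eq_mul, numPairs, mul_comm, mul_assoc]

/-- Chebyshev's inequality for the average over the first `L` generations. -/
lemma exists_chebyshev_generations (hA : 2 ≤ A) (hZ : ∀ v, Measurable (Z v)) {C σ : ℝ}
    (hC : 0 ≤ C) (hmean : ∀ v, ∫ ω, Z v ω ∂μ = 0) (hbdd : ∀ v, ∀ᵐ ω ∂μ, |Z v ω| ≤ C)
    (hvar : ∀ v, variance (Z v) μ ≤ σ ^ 2)
    (hsum : SummableMixing A (alphaMixing (tree A) μ Z)) :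
    ∃ K : ℝ, 0 < K ∧ ∀ L : ℕ, 1 ≤ L → ∀ ε : ℝ, 0 < ε →
      μ.real {ω | ε < (1 / ((generations A L).card : ℝ)) * |∑ v ∈ generations A L, Z v ω|}
        ≤ K * L / (2 ^ L * ε ^ 2) := by
  -- On `ℕ` the big-O constant serves every `L` with nonzero right-hand side, hence every `L ≥ 1`.
  obtain ⟨M, hM, hbound⟩ := bound_of_isBigO_nat_atTop hsum
  have hA0 : (0 : ℝ) < A := by exact_mod_cast (by lia : 0 < A)
  -- The `+ 1` ensures positivity; `A ^ 2` comes from squaring `A^L ≤ A |V_L|`.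
  refine ⟨(σ ^ 2 + 4 * C ^ 2 * M + 1) * A ^ 2, by positivity, fun L hL ε hε => ?_⟩
  set n : ℝ := ((generations A L).card : ℝ) with hn
  set S : Ω → ℝ := fun ω => ∑ v ∈ generations A L, Z v ω with hS
  have hL1 : (1 : ℝ) ≤ L := by exact_mod_cast hL
  have hnle : n ≤ A ^ L := by rw [hn]; exact_mod_cast card_generations_le hA L
  have hnge : (A : ℝ) ^ L ≤ A * n := by
    rw [hn]; exact_mod_cast pow_le_mul_card_generations hL
  have hApos : (0 : ℝ) < A ^ L := by positivity
  have hnpos : 0 < n := by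
    by_contra! h
    nlinarith
  have hLp : ∀ v, MemLp (Z v) 2 μ := fun v =>
    MemLp.of_bound (hZ v).aestronglyMeasurable C (hbdd v)
  have hSLp : MemLp S 2 μ := memLp_finsetSum _ fun v _ => hLp v
  have hmeanS : μ[S] = 0 := by
    rw [hS, integral_finsetSum _ fun v _ => (hLp v).integrable (by norm_num)]
    exact Finset.sum_eq_zero fun v _ => hmean v
  have hV : Var[S; μ] ≤ (σ ^ 2 + 4 * C ^ 2 * M) * (L * A ^ L) := by
    have hb := (le_abs_self _).trans (hbound (x := L) (by positivity))
    rw [Real.norm_of_nonneg (by positivity)] at hb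
    have h1 : n * σ ^ 2 ≤ L * A ^ L * σ ^ 2 :=
      mul_le_mul_of_nonneg_right (hnle.trans (le_mul_of_one_le_left hApos.le hL1)) (sq_nonneg σ)
    have h2 := mul_le_mul_of_nonneg_left hb (by positivity : 0 ≤ 4 * C ^ 2)
    linarith [variance_sum_generations_le (by lia) hZ hC hbdd hvar L]
  have hsub : {ω | ε < (1 / n) * |S ω|} ⊆ {ω | n * ε ≤ |S ω - μ[S]|} := by
    intro ω hω
    rw [Set.mem_ofPred_eq, one_div_mul_eq_div, lt_div_iff₀ hnpos] at hω
    rw [Set.mem_ofPred_eq, hmeanS, sub_zero]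
    linarith
  have hcheb : μ.real {ω | n * ε ≤ |S ω - μ[S]|} ≤ Var[S; μ] / (n * ε) ^ 2 :=
    ENNReal.toReal_le_of_le_ofReal (div_nonneg (variance_nonneg _ _) (sq_nonneg _))
      (meas_ge_le_variance_div_sq hSLp (mul_pos hnpos hε))
  refine (measureReal_mono hsub).trans (hcheb.trans ?_)
  have h2A : (2 : ℝ) ^ L ≤ A ^ L := pow_le_pow_left₀ (by norm_num) (by exact_mod_cast hA) L
  have hT : 0 ≤ σ ^ 2 + 4 * C ^ 2 * M := by positivity
  rw [div_le_div_iff₀ (by positivity) (by positivity)]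
  calc Var[S; μ] * (2 ^ L * ε ^ 2)
      ≤ (σ ^ 2 + 4 * C ^ 2 * M) * (L * A ^ L) * (A ^ L * ε ^ 2) := by gcongr
    _ = (σ ^ 2 + 4 * C ^ 2 * M) * L * ε ^ 2 * (A ^ L) ^ 2 := by ring
    _ ≤ (σ ^ 2 + 4 * C ^ 2 * M + 1) * L * ε ^ 2 * (A * n) ^ 2 := by
        gcongr ?_ * L * ε ^ 2 * ?_ ^ 2
        exact (lt_add_one _).le
    _ = (σ ^ 2 + 4 * C ^ 2 * M + 1) * A ^ 2 * L * (n * ε) ^ 2 := by ring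

/-- The exponential rate in `L` beats the rate `L / log L`, uniformly in `ε ≤ C`. -/
lemma exists_exp_bound {K C : ℝ} (hK : 0 < K) (hC : 0 < C) :
    ∃ c₁ c₂ : ℝ, 0 < c₁ ∧ 0 < c₂ ∧ ∀ L : ℕ, 2 ≤ L → ∀ ε : ℝ, 0 < ε → ε ≤ C →
      min 1 (K * L / (2 ^ L * ε ^ 2)) ≤ c₁ * Real.exp (-(c₂ * ε * ((L : ℝ) / Real.log L))) := by
  have hl : 0 < Real.log 2 := Real.log_pos (by norm_num)
  -- Thus `2^L = e^(bL) e^(bL)`: one factor absorbs `L³`, the other gives the decay. The choice of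
  -- `c₂` makes the target exponent at most `b L`, by `ε ≤ C` and `log L ≥ log 2`.
  set b := Real.log 2 / 2 with hb
  have hb0 : 0 < b := by positivity
  set c₂ := b * Real.log 2 / C with hc₂
  have hc₂0 : 0 < c₂ := by positivity
  -- One summand of `c₁` for each case, `x ≤ 1` and `x ≥ 1`; the `6` is `3!` from the exponential
  -- series.
  refine ⟨Real.exp c₂ + K / Real.log 2 ^ 2 * (6 / b ^ 3), c₂, by positivity, hc₂0,
    fun L hL ε hε hεC => ?_⟩
  have hL2 : (2 : ℝ) ≤ L := by exact_mod_cast hL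
  have hlog : Real.log 2 ≤ Real.log L := Real.log_le_log (by norm_num) hL2
  have hlog0 : 0 < Real.log L := hl.trans_le hlog
  set x := ε * ((L : ℝ) / Real.log L) with hx
  have hx0 : 0 < x := by positivity
  rw [show c₂ * ε * ((L : ℝ) / Real.log L) = c₂ * x by rw [hx, mul_assoc]]
  rcases le_total x 1 with h | h
  · calc min 1 (K * L / (2 ^ L * ε ^ 2)) ≤ 1 := min_le_left _ _
      _ = Real.exp c₂ * Real.exp (-c₂) := by rw [← Real.exp_add]; simp
      _ ≤ _ := by
        gcongr
        · exact le_add_of_nonneg_right (by positivity)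
        · exact mul_le_of_le_one_right hc₂0.le h
  -- Here `1/ε² ≤ L² / (log 2)²`, which together with the factor `L` gives `L³`.
  · have hεinv : Real.log 2 ≤ ε * L := by
      rw [hx, ← mul_div_assoc, le_div_iff₀ hlog0] at h
      linarith
    have hcx : c₂ * x ≤ b * L := by
      have h1 : x ≤ C * (L / Real.log 2) := by rw [hx]; gcongr
      calc c₂ * x ≤ c₂ * (C * (L / Real.log 2)) := by gcongr
        _ = b * L := by rw [hc₂]; field_simp
    have hcube : (L : ℝ) ^ 3 ≤ 6 / b ^ 3 * Real.exp (b * L) := by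
      have h1 := Real.pow_div_factorial_le_exp (x := b * L) (by positivity) 3
      rw [div_mul_eq_mul_div, le_div_iff₀ (by positivity)]
      have h3 : (Nat.factorial 3 : ℝ) = 6 := by norm_num [Nat.factorial]
      rw [h3, div_le_iff₀ (by norm_num), mul_pow] at h1
      linarith
    have hpow : (2 : ℝ) ^ L = Real.exp (b * L) * Real.exp (b * L) := by
      rw [← Real.exp_add, ← add_mul, hb, add_halves, mul_comm, Real.exp_nat_mul,
        Real.exp_log two_pos]
    calc min 1 (K * L / (2 ^ L * ε ^ 2)) ≤ K * L / (2 ^ L * ε ^ 2) := min_le_right _ _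
      _ ≤ K / Real.log 2 ^ 2 * L ^ 3 / 2 ^ L := by
          have h2 : Real.log 2 ^ 2 ≤ (ε * L) ^ 2 := by gcongr
          rw [div_mul_eq_mul_div, div_div, div_le_div_iff₀ (by positivity) (by positivity)]
          calc K * L * (Real.log 2 ^ 2 * 2 ^ L) ≤ K * L * ((ε * L) ^ 2 * 2 ^ L) := by gcongr
            _ = K * L ^ 3 * (2 ^ L * ε ^ 2) := by ring
      _ ≤ K / Real.log 2 ^ 2 * (6 / b ^ 3 * Real.exp (b * L)) / 2 ^ L := by gcongr
      _ = K / Real.log 2 ^ 2 * (6 / b ^ 3) * Real.exp (-(b * L)) := by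
          rw [hpow, Real.exp_neg]
          field_simp
      _ ≤ _ := by
        gcongr
        exact le_add_of_nonneg_left (Real.exp_pos _).le

/-- An average of variables bounded by `C` does not exceed `C`. -/
lemma measureReal_average_generations_eq_zero {C : ℝ} (hC : 0 ≤ C)
    (hbdd : ∀ v, ∀ᵐ ω ∂μ, |Z v ω| ≤ C) (L : ℕ) {ε : ℝ} (hε : C ≤ ε) :
    μ.real {ω | ε < (1 / ((generations A L).card : ℝ)) * |∑ v ∈ generations A L, Z v ω|} = 0 := by
  refine (measureReal_eq_zero_iff (by finiteness)).2 ?_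
  have hall : ∀ᵐ ω ∂μ, ∀ v, |Z v ω| ≤ C := ae_all_iff.2 hbdd
  refine measure_mono_null ?_ hall
  intro ω hω hle
  rw [Set.mem_ofPred_eq] at hω
  refine absurd hω (not_lt.2 (le_trans ?_ hε))
  have h : |∑ v ∈ generations A L, Z v ω| ≤ (generations A L).card * C :=
    (Finset.abs_sum_le_sum_abs _ _).trans
      ((Finset.sum_le_card_nsmul _ _ C fun v _ => hle v).trans_eq (nsmul_eq_mul _ _))
  rw [one_div_mul_eq_div]
  exact div_le_of_le_mul₀ (Nat.cast_nonneg _) hC (by linarith)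

end Deviation

end ExpTree

theorem theorem2 {Ω : Type*} [MeasurableSpace Ω] (μ : Measure Ω) [IsProbabilityMeasure μ]
    (A : ℕ) (hA : 2 ≤ A) (Z : ExpTree.Node A → Ω → ℝ) (hZ : ∀ v, Measurable (Z v))
    (C σ : ℝ) (hC : 0 < C) (hσ : 0 < σ)
    (hmean : ∀ v, ∫ ω, Z v ω ∂μ = 0)
    (hbdd : ∀ v, ∀ᵐ ω ∂μ, |Z v ω| ≤ C)
    (hvar : ∀ v, variance (Z v) μ ≤ σ ^ 2)
    (hmix : ExpTree.StrongMixing (ExpTree.tree A) μ Z) :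
    (ExpTree.SuperExponentialDecay (ExpTree.alphaMixing (ExpTree.tree A) μ Z) →
      ExpTree.SummableMixing A (ExpTree.alphaMixing (ExpTree.tree A) μ Z)) ∧
    (ExpTree.SummableMixing A (ExpTree.alphaMixing (ExpTree.tree A) μ Z) →
      ∃ c₁ c₂ : ℝ, 0 < c₁ ∧ 0 < c₂ ∧ ∀ L : ℕ, 2 ≤ L → ∀ ε : ℝ, 0 < ε →
        μ.real {ω | ε < (1 / ((ExpTree.generations A L).card : ℝ)) *
            |∑ v ∈ ExpTree.generations A L, Z v ω|}
          ≤ c₁ * Real.exp (-(c₂ * ε * ((L : ℝ) / Real.log L)))) := by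
  refine ⟨fun h => h.summableMixing hA (ExpTree.alphaMixing_nonneg (ExpTree.tree A) μ Z),
    fun h => ?_⟩
  obtain ⟨K, hK, hcheb⟩ :=
    ExpTree.exists_chebyshev_generations hA hZ hC.le hmean hbdd hvar h
  obtain ⟨c₁, c₂, hc₁, hc₂, hexp⟩ := ExpTree.exists_exp_bound hK hC
  refine ⟨c₁, c₂, hc₁, hc₂, fun L hL ε hε => ?_⟩
  rcases le_total C ε with hCε | hεC
  · rw [ExpTree.measureReal_average_generations_eq_zero hC.le hbdd L hCε]
    positivity
  · exact (le_min measureReal_le_one (hcheb L (by lia) ε hε)).trans (hexp L hL ε hε hεC)
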